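/- Let $q\equiv 1\pmod 4$ be a prime power and let $n=\tfrac12(q+1)$. Then there exist circulant symmetric integer matrices $X,Y$ of order $n$ such that $X$ has zero diagonal and all other entries $\pm1$, $Y$ has all entries $\pm1$, and $XX^{\top}+YY^{\top}=qI$ (such matrices are due to Turyn), and for which the following holds. The matrices $A=X+I$, $B=C=Y$, $D=X-I$ are propus matrices of order $n$, that is, they are circulant symmetric matrices with entries $\pm1$ satisfying $$AA^{\top}+2BB^{\top}+DD^{\top}=4nI,$$ and the propus array $$\begin{bmatrix}A&B&B&D\\ B&D&-A&-B\\ B&-A&-D&B\\ D&-B&B&-A\end{bmatrix}$$ is a symmetric Hadamard matrix of order $4n=2(q+1)$ (a symmetric matrix $H$ with entries $\pm1$ and $HH^{\top}=H^{\top}H=2(q+1)I$). -/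

import Mathlib

open scoped Matrix

namespace Propus

/-- `M` is a circulant matrix of order `n`: each entry `M i j` depends only on `i - j` modulo `n`. -/
def IsCirculant {n : ℕ} (M : Matrix (Fin n) (Fin n) ℤ) : Prop :=
  ∃ v : Fin n → ℤ, M = Matrix.circulant v

/-- All entries of `M` are `1` or `-1`. -/
def IsSignMatrix {m : Type*} (M : Matrix m m ℤ) : Prop :=
  ∀ i j, M i j = 1 ∨ M i j = -1

/-- `A`, `B`, `C`, `D` are propus matrices of order `n`: four circulant symmetric `±1` matrices,
with `B = C`, satisfying the additive property. -/
structure IsPropus {n : ℕ} (A B C D : Matrix (Fin n) (Fin n) ℤ) : Prop where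
  sign_A : IsSignMatrix A
  sign_B : IsSignMatrix B
  sign_D : IsSignMatrix D
  circ_A : IsCirculant A
  circ_B : IsCirculant B
  circ_D : IsCirculant D
  symm_A : A.IsSymm
  symm_B : B.IsSymm
  symm_D : D.IsSymm
  eq_BC : B = C
  additive : A * Aᵀ + 2 • (B * Bᵀ) + D * Dᵀ = (4 * n : ℤ) • (1 : Matrix (Fin n) (Fin n) ℤ)

/-- The propus array, with the blocks `A`, `B`, `D` of order `n` written out as a single matrix of
order `4 * n`; the entry at row `n * k + i`, column `n * l + j` is the `(i, j)` entry of the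
`(k, l)` block. -/
def propusArray {n : ℕ} (A B D : Matrix (Fin n) (Fin n) ℤ) :
    Matrix (Fin (4 * n)) (Fin (4 * n)) ℤ :=
  Matrix.reindex finProdFinEquiv finProdFinEquiv <|
    Matrix.comp (Fin 4) (Fin 4) (Fin n) (Fin n) ℤ
      !![A,  B,  B,  D;
         B,  D, -A, -B;
         B, -A, -D,  B;
         D, -B,  B, -A]

/-- `X`, `Y` are circulant matrices as in Turyn's theorem for `q`: both symmetric and of order `n`,
`X` with zero diagonal and other entries `±1`, `Y` with entries `±1`, and `X Xᵀ + Y Yᵀ = q I`. -/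
structure IsTurynPair (q : ℕ) {n : ℕ} (X Y : Matrix (Fin n) (Fin n) ℤ) : Prop where
  circ_X : IsCirculant X
  circ_Y : IsCirculant Y
  symm_X : X.IsSymm
  symm_Y : Y.IsSymm
  diag_X : ∀ i, X i i = 0
  offDiag_X : ∀ i j, i ≠ j → X i j = 1 ∨ X i j = -1
  sign_Y : IsSignMatrix Y
  sum_eq : X * Xᵀ + Y * Yᵀ = (q : ℤ) • (1 : Matrix (Fin n) (Fin n) ℤ)

end Propus

/-! ### Passing from a Turyn pair to propus matrices and the propus array. -/

namespace Propus

/-! Let `K = F(ω)`, `ω ^ 2 = a` a nonsquare, be the quadratic extension of the field `F` of order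
`q`, and let `u` have order `n` in `Kˣ`. With `χ` the quadratic character of `F`, the first columns
of `X` and `Y` are `χ (im u^i)` and `χ (re u^i)`. Since `n` is odd and coprime to `q - 1`, every
element of `Kˣ` is uniquely `c u^i` or `c ω u^i` with `c ∈ Fˣ`. Hence `q - 1` times an entry of `XXᵀ
+ YYᵀ` is a sum of `χ (im x) χ (im (x w))` over `K` (`card_sub_one_mul_sum`), which vanishes for `w
∉ F` and is `q (q - 1)` for `w = 1`. The rest is block algebra with commuting circulants. -/

theorem IsCirculant.commute {n : ℕ} {M N : Matrix (Fin n) (Fin n) ℤ} (hM : IsCirculant M)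
    (hN : IsCirculant N) : M * N = N * M := by
  obtain ⟨v, rfl⟩ := hM
  obtain ⟨w, rfl⟩ := hN
  exact Matrix.Fin.circulant_mul_comm v w

theorem propusArray_isSymm {n : ℕ} {A B D : Matrix (Fin n) (Fin n) ℤ} (hA : A.IsSymm)
    (hB : B.IsSymm) (hD : D.IsSymm) : (propusArray A B D).IsSymm := by
  have key : ∀ (i j : Fin 4), (!![A,  B,  B,  D;
         B,  D, -A, -B;
         B, -A, -D,  B;
         D, -B,  B, -A] i j)ᵀ = !![A,  B,  B,  D;
         B,  D, -A, -B;
         B, -A, -D,  B;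
         D, -B,  B, -A] j i := by
    intro i j
    fin_cases i <;> fin_cases j <;> simp [hA.eq, hB.eq, hD.eq]
  ext i j
  exact congrFun (congrFun (key (finProdFinEquiv.symm j).1 (finProdFinEquiv.symm i).1)
    (finProdFinEquiv.symm i).2) (finProdFinEquiv.symm j).2

theorem propusArray_isSignMatrix {n : ℕ} {A B D : Matrix (Fin n) (Fin n) ℤ} (hA : IsSignMatrix A)
    (hB : IsSignMatrix B) (hD : IsSignMatrix D) : IsSignMatrix (propusArray A B D) := by
  have key : ∀ (k l : Fin 4), IsSignMatrix (!![A,  B,  B,  D;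
         B,  D, -A, -B;
         B, -A, -D,  B;
         D, -B,  B, -A] k l) := by
    have neg : ∀ {M : Matrix (Fin n) (Fin n) ℤ}, IsSignMatrix M → IsSignMatrix (-M) := by
      intro M hM i j
      rcases hM i j with h | h <;> simp [h]
    intro k l
    fin_cases k <;> fin_cases l <;> simp [hA, hB, hD, neg]
  intro i j
  exact key (finProdFinEquiv.symm i).1 (finProdFinEquiv.symm j).1 _ _

/-- Off-diagonal blocks of the square cancel by commutativity; each diagonal block is `A² + 2B² +
D²`. -/
theorem propusArray_mul_self {n : ℕ} {A B D : Matrix (Fin n) (Fin n) ℤ} {c : ℤ}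
    (hAB : A * B = B * A) (hAD : A * D = D * A) (hBD : B * D = D * B)
    (h : A * A + 2 • (B * B) + D * D = c • (1 : Matrix (Fin n) (Fin n) ℤ)) :
    propusArray A B D * propusArray A B D = c • (1 : Matrix (Fin (4 * n)) (Fin (4 * n)) ℤ) := by
  have key : !![A,  B,  B,  D;
         B,  D, -A, -B;
         B, -A, -D,  B;
         D, -B,  B, -A] * !![A,  B,  B,  D;
         B,  D, -A, -B;
         B, -A, -D,  B;
         D, -B,  B, -A] = c • (1 : Matrix (Fin 4) (Fin 4) (Matrix (Fin n) (Fin n) ℤ)) := by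
    ext1 k l
    fin_cases k <;> fin_cases l <;>
      simp [Matrix.mul_apply, Fin.sum_univ_four, hAB, hAD, hBD, ← h, two_mul] <;> abel
  have hsmul : ∀ M : Matrix (Fin 4) (Fin 4) (Matrix (Fin n) (Fin n) ℤ),
      Matrix.compRingEquiv (Fin 4) (Fin n) ℤ (c • M) =
        c • Matrix.compRingEquiv (Fin 4) (Fin n) ℤ M := fun M => map_zsmul _ c M
  have := congrArg (Matrix.compRingEquiv (Fin 4) (Fin n) ℤ) key
  rw [map_mul, hsmul, map_one] at this
  unfold propusArray
  rw [Matrix.reindex_apply, Matrix.submatrix_mul_equiv]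
  -- `Matrix.comp` and `Matrix.compRingEquiv` agree only after unfolding.
  erw [this]
  rw [Matrix.submatrix_smul, Pi.smul_apply, Pi.smul_apply, Matrix.submatrix_one_equiv]

theorem IsPropus.isHadamard_propusArray {n : ℕ} {A B C D : Matrix (Fin n) (Fin n) ℤ}
    (h : IsPropus A B C D) : (propusArray A B D).IsHadamard := by
  have hadd := h.additive
  rw [h.symm_A.eq, h.symm_B.eq, h.symm_D.eq] at hadd
  have hsq := propusArray_mul_self (h.circ_A.commute h.circ_B) (h.circ_A.commute h.circ_D)
    (h.circ_B.commute h.circ_D) hadd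
  have hstar : (propusArray A B D)ᴴ = propusArray A B D := by
    rw [Matrix.conjTranspose_eq_transpose_of_trivial]
    exact propusArray_isSymm h.symm_A h.symm_B h.symm_D
  refine ⟨fun i j => ?_, ?_, ?_⟩
  · rcases propusArray_isSignMatrix h.sign_A h.sign_B h.sign_D i j with h | h <;> rw [h]
    · exact one_mem _
    · simp [Unitary.mem_iff]
  all_goals rw [hstar, hsq]; simp

/-- The cross terms cancel: `(X + 1)² + (X - 1)² = 2X² + 2`, so the total is `2q + 2 = 4n` times the
identity. -/
theorem IsTurynPair.isPropus {q n : ℕ} (hn : 2 * n = q + 1) {X Y : Matrix (Fin n) (Fin n) ℤ}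
    (h : IsTurynPair q X Y) : IsPropus (X + 1) Y Y (X - 1) := by
  have circ_one : IsCirculant (1 : Matrix (Fin n) (Fin n) ℤ) := by
    rcases n with _ | n
    · exact ⟨0, Subsingleton.elim _ _⟩
    · exact ⟨Pi.single 0 1, (Matrix.circulant_single_one ℤ (Fin (n + 1))).symm⟩
  obtain ⟨v, hv⟩ := h.circ_X
  obtain ⟨w, hw⟩ := circ_one
  refine ⟨fun i j => ?_, h.sign_Y, fun i j => ?_, ⟨v + w, ?_⟩, h.circ_Y, ⟨v - w, ?_⟩,
    h.symm_X.add Matrix.isSymm_one, h.symm_Y, h.symm_X.sub Matrix.isSymm_one, rfl, ?_⟩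
  · by_cases hij : i = j
    · subst hij; simp [h.diag_X]
    · simpa [Matrix.one_apply_ne hij] using h.offDiag_X i j hij
  · by_cases hij : i = j
    · subst hij; simp [h.diag_X]
    · simpa [Matrix.one_apply_ne hij] using h.offDiag_X i j hij
  · rw [Matrix.circulant_add, ← hv, ← hw]
  · rw [Matrix.circulant_sub, ← hv, ← hw]
  · have hs := h.sum_eq
    have hq : (4 * n : ℤ) = 2 * q + 2 := by push_cast [← @Nat.cast_inj ℤ] at hn; linarith
    rw [hq, Matrix.transpose_add, Matrix.transpose_sub, Matrix.transpose_one, add_smul, mul_smul,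
      ← hs]
    noncomm_ring

/-! ### Turyn pairs from a quadratic extension of a finite field. -/

section Turyn

open QuadraticAlgebra

variable {F : Type*} [Field F] [Fintype F] {a : F}

/-- Such a `z` lies in `Fˣ`, so its order divides both `n` and `q - 1`. -/
theorem eq_one_of_pow_eq_one_of_im_eq_zero {n : ℕ} (hn0 : n ≠ 0)
    (hn : n.Coprime (Fintype.card F - 1))
    {z : QuadraticAlgebra F a 0} (hz : z ^ n = 1) (him : z.im = 0) : z = 1 := by
  obtain ⟨x, rfl⟩ : ∃ x : F, algebraMap F (QuadraticAlgebra F a 0) x = z :=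
    ⟨z.re, by ext <;> simp [him]⟩
  rw [← map_pow, ← map_one (algebraMap F _), algebraMap_inj] at hz
  have hx : x ≠ 0 := by
    rintro rfl
    simp [zero_pow hn0] at hz
  rw [show x = 1 from ?_, map_one]
  have h1 := orderOf_dvd_of_pow_eq_one hz
  have h2 := orderOf_dvd_of_pow_eq_one (FiniteField.pow_card_sub_one_eq_one x hx)
  exact orderOf_eq_one_iff.mp (Nat.eq_one_of_dvd_coprimes hn h1 h2)

/-- A multiple of `ω` has its square in `F`; that square is then `1`, and odd `n` forces `z = 1`. -/
theorem re_ne_zero_of_pow_eq_one {n : ℕ} (hn : n.Coprime (Fintype.card F - 1)) (hodd : Odd n)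
    {z : QuadraticAlgebra F a 0} (hz : z ^ n = 1) : z.re ≠ 0 := by
  intro hre
  have hsq : z ^ 2 = 1 := eq_one_of_pow_eq_one_of_im_eq_zero hodd.pos.ne' hn
    (by rw [← pow_mul, mul_comm, pow_mul, hz, one_pow]) (by simp [sq, hre])
  have : z = 1 := by
    obtain ⟨k, rfl⟩ := hodd
    rw [pow_succ, pow_mul, hsq, one_pow, one_mul] at hz
    exact hz
  simp [this] at hre

theorem norm_eq_one_of_pow_eq_one [Fact (∀ r : F, r ^ 2 ≠ a + 0 * r)] {n : ℕ} (hn : n.Coprime (Fintype.card F - 1))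
    {z : QuadraticAlgebra F a 0} (hz0 : z ≠ 0) (hz : z ^ n = 1) : norm z = 1 := by
  have h1 := orderOf_dvd_of_pow_eq_one (show norm z ^ n = 1 by rw [← map_pow, hz, map_one])
  have h2 := orderOf_dvd_of_pow_eq_one
    (FiniteField.pow_card_sub_one_eq_one (norm z) (by simpa [norm_eq_zero_iff_eq_zero] using hz0))
  exact orderOf_eq_one_iff.mp (Nat.eq_one_of_dvd_coprimes hn h1 h2)

variable [DecidableEq F]

/-- For fixed `im x`, the map `re x ↦ im (x w)` is an affine bijection of `F`, so the inner sum is a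
full character sum. -/
theorem sum_quadraticChar_im_mul_im (hF : ringChar F ≠ 2) {w : QuadraticAlgebra F a 0}
    (hw : w.im ≠ 0) [Fintype (QuadraticAlgebra F a 0)] :
    ∑ x : QuadraticAlgebra F a 0, quadraticChar F x.im * quadraticChar F (x * w).im = 0 := by
  rw [← (equivProd a 0).symm.sum_comp, Fintype.sum_prod_type_right]
  refine Finset.sum_eq_zero fun y _ => ?_
  simp only [equivProd, Equiv.coe_fn_symm_mk, im_mul]
  rw [← Finset.mul_sum]
  refine mul_eq_zero_of_right _ ?_
  rw [← quadraticChar_sum_zero hF]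
  refine Eq.trans ?_ (((Equiv.mulRight₀ w.im hw).trans
    (Equiv.addRight (y * w.re))).sum_comp (quadraticChar F))
  refine Finset.sum_congr rfl fun x _ => ?_
  rw [zero_mul, zero_mul, add_zero]
  rfl

theorem sum_quadraticChar_im_sq [Fintype (QuadraticAlgebra F a 0)] :
    ∑ x : QuadraticAlgebra F a 0, quadraticChar F x.im * quadraticChar F x.im =
      Fintype.card F * ((Fintype.card F : ℤ) - 1) := by
  rw [← (equivProd a 0).symm.sum_comp, Fintype.sum_prod_type]
  simp only [equivProd, Equiv.coe_fn_symm_mk]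
  rw [Finset.sum_const, Finset.card_univ, nsmul_eq_mul]
  congr 1
  rw [← Finset.sum_erase_add _ _ (Finset.mem_univ (0 : F))]
  rw [Finset.sum_congr rfl fun x hx => show _ = (1 : ℤ) by
    rw [← sq, quadraticChar_sq_one (Finset.ne_of_mem_erase hx)]]
  simp [Finset.card_erase_of_mem, Nat.cast_sub Fintype.card_pos]

variable [Fact (∀ r : F, r ^ 2 ≠ a + 0 * r)]

theorem card_sub_one_mul_sum {n : ℕ} (hn : n.Coprime (Fintype.card F - 1)) (hodd : Odd n)
    (hcard : 2 * n = Fintype.card F + 1) {v : Fin n → (QuadraticAlgebra F a 0)ˣ}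
    (hv : Function.Injective v) (hpow : ∀ i, v i ^ n = 1) (w : QuadraticAlgebra F a 0)
    [Fintype (QuadraticAlgebra F a 0)] :
    ((Fintype.card F : ℤ) - 1) * ∑ i,
      (quadraticChar F (v i : QuadraticAlgebra F a 0).im *
          quadraticChar F ((v i : QuadraticAlgebra F a 0) * w).im +
        quadraticChar F (v i : QuadraticAlgebra F a 0).re *
          quadraticChar F ((v i : QuadraticAlgebra F a 0) * w).re) =
      ∑ x : QuadraticAlgebra F a 0, quadraticChar F x.im * quadraticChar F (x * w).im := by
  have hω : (ω : QuadraticAlgebra F a 0) ≠ 0 := by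
    intro h
    simpa using congrArg im h
  let ι : Fˣ →* (QuadraticAlgebra F a 0)ˣ := Units.map (algebraMap F (QuadraticAlgebra F a 0))
  have hι : Function.Injective ι := Units.map_injective (algebraMap F _).injective
  have hιre : ∀ c, (ι c : QuadraticAlgebra F a 0).re = c := fun c => rfl
  have hιim : ∀ c, (ι c : QuadraticAlgebra F a 0).im = 0 := fun c => rfl
  let g : (Fˣ × Fin n) ⊕ (Fˣ × Fin n) → (QuadraticAlgebra F a 0)ˣ :=
    Sum.elim (fun p => ι p.1 * v p.2) (fun p => ι p.1 * Units.mk0 ω hω * v p.2)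
  have hdiv : ∀ i j, ((v i / v j : (QuadraticAlgebra F a 0)ˣ) : QuadraticAlgebra F a 0) ^ n = 1 := by
    intro i j
    rw [← Units.val_pow_eq_pow_val, div_pow, hpow, hpow, div_one, Units.val_one]
  have hsame : ∀ c d i j, ι c * v i = ι d * v j → c = d ∧ i = j := by
    intro c d i j h
    have hq : v i / v j = ι (d / c) := by
      rw [map_div, div_eq_div_iff_mul_eq_mul, mul_comm, h]
    have h1 : v i / v j = 1 := Units.ext <|
      eq_one_of_pow_eq_one_of_im_eq_zero hodd.pos.ne' hn (hdiv i j) (by rw [hq, hιim])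
    have hij : v i = v j := div_eq_one.mp h1
    rw [hij] at h
    exact ⟨hι (mul_right_cancel h), hv hij⟩
  -- Otherwise `v i / v j` would be an `n`-th root of unity in `F ω`, with zero real part.
  have hdiff : ∀ c d i j, ι c * v i ≠ ι d * Units.mk0 ω hω * v j := by
    intro c d i j h
    have hq : v i / v j = ι (d / c) * Units.mk0 ω hω := by
      rw [map_div, div_mul_eq_mul_div, div_eq_div_iff_mul_eq_mul, mul_comm, h]
    refine re_ne_zero_of_pow_eq_one hn hodd (hdiv i j) ?_
    rw [hq]
    simp [hιim]
  have hg : Function.Bijective g := by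
    rw [Fintype.bijective_iff_injective_and_card]
    constructor
    · rintro (⟨c, i⟩ | ⟨c, i⟩) (⟨d, j⟩ | ⟨d, j⟩) h
      · obtain ⟨rfl, rfl⟩ := hsame c d i j h
        rfl
      · exact (hdiff c d i j h).elim
      · exact (hdiff d c j i h.symm).elim
      · obtain ⟨rfl, rfl⟩ := hsame c d i j (by
          simp only [g, Sum.elim_inr] at h
          rwa [mul_right_comm, mul_right_comm (ι d), mul_left_inj] at h)
        rfl
    -- The count is `2n(q - 1) = (q + 1)(q - 1) = q² - 1`.
    · have hK : Fintype.card (QuadraticAlgebra F a 0) = Fintype.card F * Fintype.card F := by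
        rw [Fintype.card_congr (equivProd a 0), Fintype.card_prod]
      rw [Fintype.card_sum, Fintype.card_prod, Fintype.card_fin, Fintype.card_units,
        Fintype.card_units, hK]
      have hpos : 0 < Fintype.card F := Fintype.card_pos
      obtain ⟨m, hm⟩ := Nat.exists_eq_add_of_lt hpos
      rw [hm] at hcard ⊢
      have : 2 * n = m + 2 := by omega
      simp only [zero_add, Nat.add_sub_cancel]
      rw [← two_mul, mul_left_comm, this]
      exact (Nat.sub_eq_of_eq_add (by ring)).symm
  have hunits : ∑ x : QuadraticAlgebra F a 0, quadraticChar F x.im * quadraticChar F (x * w).im =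
      ∑ x : (QuadraticAlgebra F a 0)ˣ, quadraticChar F (x : QuadraticAlgebra F a 0).im *
        quadraticChar F ((x : QuadraticAlgebra F a 0) * w).im := by
    refine (Fintype.sum_of_injective Units.val Units.val_injective _ _ (fun x hx => ?_)
      fun _ => rfl).symm
    have hx0 : x = 0 := by
      by_contra h
      exact hx ⟨Units.mk0 x h, rfl⟩
    simp [hx0]
  have hcu : (Fintype.card Fˣ : ℤ) = Fintype.card F - 1 := by
    rw [Fintype.card_units, Nat.cast_sub Fintype.card_pos, Nat.cast_one]
  have hsc : ∀ (c : Fˣ) (x y : F),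
      quadraticChar F (c * x) * quadraticChar F (c * y) = quadraticChar F x * quadraticChar F y := by
    intro c x y
    rw [map_mul, map_mul, mul_mul_mul_comm, ← sq, quadraticChar_sq_one c.ne_zero, one_mul]
  rw [hunits, ← hg.sum_comp, Fintype.sum_sum_type, Fintype.sum_prod_type, Fintype.sum_prod_type,
    ← Finset.sum_add_distrib, ← hcu]
  rw [← nsmul_eq_mul, ← Finset.card_univ, ← Finset.sum_const]
  refine Finset.sum_congr rfl fun c _ => ?_
  rw [← Finset.sum_add_distrib]
  refine Finset.sum_congr rfl fun i _ => ?_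
  simp only [g, Sum.elim_inl, Sum.elim_inr, Units.val_mul, Units.val_mk0]
  congr 1
  · rw [← hsc c]
    simp [hιre, hιim, mul_assoc]
  -- The factor `ω` turns imaginary parts into real ones: `im (ω z) = re z`.
  · rw [← hsc c]
    simp [hιre, hιim, mul_assoc]

theorem isTurynPair_circulant {n : ℕ} [NeZero n] (hn : n.Coprime (Fintype.card F - 1))
    (hodd : Odd n) (hcard : 2 * n = Fintype.card F + 1) (hF : ringChar F ≠ 2)
    (hneg : quadraticChar F (-1) = 1) {u : (QuadraticAlgebra F a 0)ˣ} (hu : orderOf u = n) :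
    IsTurynPair (Fintype.card F)
      (Matrix.circulant fun i : Fin n =>
        quadraticChar F ((u ^ (i : ℕ) : (QuadraticAlgebra F a 0)ˣ) : QuadraticAlgebra F a 0).im)
      (Matrix.circulant fun i : Fin n =>
        quadraticChar F
          ((u ^ (i : ℕ) : (QuadraticAlgebra F a 0)ˣ) : QuadraticAlgebra F a 0).re) := by
  let : Fintype (QuadraticAlgebra F a 0) := Fintype.ofEquiv _ (equivProd a 0).symm
  have hun : u ^ n = 1 := hu ▸ pow_orderOf_eq_one u
  set v : Fin n → (QuadraticAlgebra F a 0)ˣ := fun i => u ^ (i : ℕ) with hvdef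
  have hvn : ∀ i, v i ^ n = 1 := fun i => by
    rw [hvdef, ← pow_mul, mul_comm, pow_mul, hun, one_pow]
  have hvn' : ∀ i, (v i : QuadraticAlgebra F a 0) ^ n = 1 := fun i => by
    rw [← Units.val_pow_eq_pow_val, hvn, Units.val_one]
  have hv0 : v 0 = 1 := by simp [hvdef]
  have hinj : Function.Injective v := fun i j h => Fin.ext <|
    pow_injOn_Iio_orderOf (by simp [hu]) (by simp [hu]) h
  have hadd : ∀ i j, v (i + j) = v i * v j := fun i j => by
    simp only [hvdef, Fin.val_add, ← pow_add]
    rw [pow_eq_pow_iff_modEq, hu]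
    exact Nat.mod_modEq _ _
  -- Norm `1` makes inversion equal to conjugation; with `χ (-1) = 1` this gives the symmetry of `X`
  -- and `Y`.
  have hnegv : ∀ i, (v (-i) : QuadraticAlgebra F a 0) = star (v i : QuadraticAlgebra F a 0) := by
    intro i
    have h1 : (v i : QuadraticAlgebra F a 0) * v (-i) = 1 := by
      rw [← Units.val_mul, ← hadd, add_neg_cancel, hv0, Units.val_one]
    have h2 : (v i : QuadraticAlgebra F a 0) * star (v i : QuadraticAlgebra F a 0) = 1 := by
      rw [← algebraMap_norm_eq_mul_star,
        norm_eq_one_of_pow_eq_one hn (v i).ne_zero (hvn' i), map_one]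
    exact mul_left_cancel₀ (v i).ne_zero (h1.trans h2.symm)
  have him : ∀ i, i ≠ 0 → (v i : QuadraticAlgebra F a 0).im ≠ 0 := fun i hi h =>
    hi <| hinj <| by
      rw [hv0]
      exact Units.ext (eq_one_of_pow_eq_one_of_im_eq_zero hodd.pos.ne' hn (hvn' i) h)
  change IsTurynPair _
    (Matrix.circulant fun i : Fin n => quadraticChar F (v i : QuadraticAlgebra F a 0).im)
    (Matrix.circulant fun i : Fin n => quadraticChar F (v i : QuadraticAlgebra F a 0).re)
  clear_value v
  refine ⟨⟨_, rfl⟩, ⟨_, rfl⟩, ?_, ?_, ?_, ?_, ?_, ?_⟩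
  · refine Matrix.circulant_isSymm_iff.mpr fun i => ?_
    change quadraticChar F (v (-i) : QuadraticAlgebra F a 0).im = quadraticChar F _
    rw [hnegv, im_star, neg_eq_neg_one_mul, map_mul, hneg, one_mul]
  · refine Matrix.circulant_isSymm_iff.mpr fun i => ?_
    change quadraticChar F (v (-i) : QuadraticAlgebra F a 0).re = quadraticChar F _
    rw [hnegv, re_star, zero_mul, add_zero]
  · intro i
    rw [Matrix.circulant_apply, sub_self, hv0]
    simp
  · intro i j hij
    exact quadraticChar_dichotomy (him _ (sub_ne_zero.mpr hij))
  · intro i j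
    exact quadraticChar_dichotomy (re_ne_zero_of_pow_eq_one hn hodd (hvn' _))
  · ext i j
    have hq : ((Fintype.card F : ℤ) - 1) ≠ 0 := by
      have : 1 < Fintype.card F := Fintype.one_lt_card
      omega
    have hsum := card_sub_one_mul_sum hn hodd hcard hinj hvn (v (j - i))
    simp only [Matrix.add_apply, Matrix.mul_apply, Matrix.transpose_apply, Matrix.circulant_apply,
      ← Finset.sum_add_distrib]
    -- Substituting `k ↦ i - k` turns the entry into a correlation of `v k` with `v k * v (j - i)`.
    rw [← (Equiv.subLeft i).sum_comp]
    have harg : ∀ k, j - (i - k) = k + (j - i) := fun k => by abel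
    simp only [Equiv.subLeft_apply, sub_sub_cancel, harg, hadd, Units.val_mul]
    refine mul_left_cancel₀ hq (hsum.trans ?_)
    by_cases hij : i = j
    · subst hij
      rw [sub_self, hv0]
      simp only [Units.val_one, mul_one, sum_quadraticChar_im_sq]
      simp [mul_comm]
    · rw [sum_quadraticChar_im_mul_im hF (him _ (sub_ne_zero.mpr (Ne.symm hij)))]
      simp [Matrix.one_apply_ne hij]

theorem exists_isTurynPair {q n : ℕ} (hq : IsPrimePow q) (hq4 : q ≡ 1 [MOD 4])
    (hn : 2 * n = q + 1) : ∃ X Y : Matrix (Fin n) (Fin n) ℤ, IsTurynPair q X Y := by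
  classical
  have hmod : q % 4 = 1 := hq4
  obtain ⟨p, k, hp, hk, rfl⟩ := hq
  have : Fact p.Prime := ⟨hp.nat_prime⟩
  let F := GaloisField p k
  let : Fintype F := Fintype.ofFinite F
  have hcF : Fintype.card F = p ^ k := by
    rw [← Nat.card_eq_fintype_card, GaloisField.card p k hk.ne']
  have hF : ringChar F ≠ 2 := by
    rw [Ne, FiniteField.even_card_iff_char_two, hcF]
    omega
  have hneg : quadraticChar F (-1) = 1 := by
    rw [quadraticChar_one_iff_isSquare (neg_ne_zero.mpr one_ne_zero),
      FiniteField.isSquare_neg_one_iff, hcF]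
    omega
  obtain ⟨a, ha⟩ := FiniteField.exists_nonsquare hF
  have : Fact (∀ r : F, r ^ 2 ≠ a + 0 * r) := ⟨fun r hr => ha ⟨r, by
    rw [← sq, hr, zero_mul, add_zero]⟩⟩
  let : Fintype (QuadraticAlgebra F a 0) := Fintype.ofEquiv _ (equivProd a 0).symm
  have hcK : Nat.card (QuadraticAlgebra F a 0)ˣ = n * (2 * (p ^ k - 1)) := by
    rw [Nat.card_units, Nat.card_congr (equivProd a 0), Nat.card_prod, Nat.card_eq_fintype_card,
      hcF, ← mul_assoc, mul_comm n, hn, ← Nat.sq_sub_sq _ 1, sq, one_pow]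
  have hodd : Odd n := by
    rw [Nat.odd_iff]
    omega
  have : NeZero n := ⟨hodd.pos.ne'⟩
  have hcop : n.Coprime (Fintype.card F - 1) := by
    rw [hcF]
    -- Because `2n - (q - 1) = 2`; as `n` is odd, the gcd is `1`.
    have h2 : n.gcd (p ^ k - 1) ∣ 2 := by
      have h := Nat.dvd_sub ((Nat.gcd_dvd_left n (p ^ k - 1)).mul_left 2)
        (Nat.gcd_dvd_right n (p ^ k - 1))
      rwa [show 2 * n - (p ^ k - 1) = 2 by omega] at h
    exact Nat.Coprime.eq_one_of_dvd
      ((Nat.coprime_two_right.mpr hodd).coprime_dvd_left (Nat.gcd_dvd_left _ _)) h2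
  obtain ⟨u, hu⟩ := IsCyclic.exists_ofOrder_eq_natCard (α := (QuadraticAlgebra F a 0)ˣ)
  have hpos : 2 * (p ^ k - 1) ≠ 0 := by
    have : 1 < p ^ k := Nat.one_lt_pow hk.ne' hp.nat_prime.one_lt
    omega
  -- `u` generates the cyclic group `Kˣ`, of order `q² - 1 = n · 2(q - 1)`.
  have hord : orderOf (u ^ (2 * (p ^ k - 1))) = n := by
    rw [orderOf_pow_of_dvd hpos (by rw [hu, hcK]; exact dvd_mul_left _ _), hu, hcK,
      Nat.mul_div_cancel _ (Nat.pos_of_ne_zero hpos)]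
  rw [← hcF] at hn ⊢
  exact ⟨_, _, isTurynPair_circulant hcop hodd hn hF hneg hord⟩

end Turyn

end Propus

theorem lemma1 (q n : ℕ) (hq : IsPrimePow q) (hq4 : q ≡ 1 [MOD 4]) (hn : 2 * n = q + 1) :
    ∃ X Y A B C D : Matrix (Fin n) (Fin n) ℤ,
      Propus.IsTurynPair q X Y ∧
      A = X + 1 ∧ B = Y ∧ C = Y ∧ D = X - 1 ∧
      Propus.IsPropus A B C D ∧
      (Propus.propusArray A B D).IsSymm ∧
      (Propus.propusArray A B D).IsHadamard ∧
      4 * n = 2 * (q + 1) := by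
  obtain ⟨X, Y, h⟩ := Propus.exists_isTurynPair hq hq4 hn
  have hP := h.isPropus hn
  exact ⟨X, Y, X + 1, Y, Y, X - 1, h, rfl, rfl, rfl, rfl, hP,
    Propus.propusArray_isSymm hP.symm_A hP.symm_B hP.symm_D, hP.isHadamard_propusArray, by omega⟩
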